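/- Let $K$ be a field. A transformation-pair $[\mu,\nu:E\to V]$ over $K$ consists of two linear maps $\mu,\nu$ between finite-dimensional $K$-vector spaces $E$ and $V$; direct sums are formed componentwise, and an isomorphism $[\mu,\nu:E\to V]\to[\mu',\nu':E'\to V']$ is a pair of linear isomorphisms $\alpha:E\to E'$, $\beta:V\to V'$ with $\mu'\alpha=\beta\mu$ and $\nu'\alpha=\beta\nu$. Let $f_1,f_2,\dots$ denote the standard basis vectors of $K^n$ (or $K^{n\pm1}$). Kronecker's list $\mathcal L(K)$ consists of the following transformation-pairs $\tau$, to each of which we attach an edge-number $\mathcal E(\tau)$ and a vertex-number $\mathcal V(\tau)$: - ${}^0T_n=[\mu_n,I:K^n\to K^n]$ and $T_n^0=[I,\mu_n:K^n\to K^n]$ for $n\ge1$, where $\mu_n: f_1\mapsto f_2\mapsto\dots\mapsto f_n\mapsto 0$; $\mathcal E=\mathcal V=n$; - $T_n=[\kappa_n,\lambda_n:K^n\to K^{n+1}]$ for $n\ge0$, where $\kappa_n f_i=f_i$ and $\lambda_n f_i=f_{i+1}$; $\mathcal E=n$, $\mathcal V=n+1$; - ${}^0T_n^0=[\kappa_n',\lambda_n':K^{n+1}\to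 K^n]$ for $n\ge0$, where $\kappa_n'f_i=f_i$ for $i\le n$, $\kappa_n'f_{n+1}=0$, $\lambda_n'f_1=0$ and $\lambda_n'f_{i+1}=f_i$ for $1\le i\le n$; $\mathcal E=n+1$, $\mathcal V=n$; - $S(p^n)=[\xi,I:K[X]/(p^n)\to K[X]/(p^n)]$ for $n\ge1$ and $p\ne X$ monic irreducible in $K[X]$, where $\xi$ is multiplication by $X$; $\mathcal E=\mathcal V=n\deg p$. Let $\Gamma=(R\subseteq S\times S)$ be a binary relation on a finite set $S$, put $\mathcal E(\Gamma)=\#R$ and $\mathcal V(\Gamma)=\#S$, and let $K(\Gamma)=[\mu_\Gamma,\nu_\Gamma:KR\to KS]$ be its $K$-linearization, where $KR$ and $KS$ are the vector spaces with bases $R$ and $S$, and $\mu_\Gamma(a,b)=a$, $\nu_\Gamma(a,b)=b$ for $(a,b)\in R$. Let $$K(\Gamma)\cong\bigoplus_{\tau\in\mathcal L(K)}[\Gamma:\tau]\,\tau$$ be a Kronecker decomposition of $K(\Gamma)$, where the multiplicities $[\Gamma:\tau]$ are non-negative integers, all but finitely many of them zero. Then $$\mathcal E(\Gamma)=\sum_{\tau\in\mathcal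 L(K)}[\Gamma:\tau]\,\mathcal E(\tau),\qquad \mathcal V(\Gamma)=\sum_{\tau\in\mathcal L(K)}[\Gamma:\tau]\,\mathcal V(\tau).$$ In particular, the multiplicity of ${}^0T^0_0$ is determined by the other multiplicities and the number of edges: $$[\Gamma:{}^0T^0_0]=\mathcal E(\Gamma)-\sum_{\tau\in\mathcal L(K),\ \tau\ne{}^0T^0_0}[\Gamma:\tau]\,\mathcal E(\tau).$$ -/

import Mathlib

open Polynomial

noncomputable section

universe u v w

/-- A transformation-pair `[μ, ν : E → V]` over the field `K`: two linear maps between the same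
two finite-dimensional vector spaces. -/
structure TsfPair (K : Type u) [Field K] where
  E : Type v
  V : Type v
  [addCommGroupE : AddCommGroup E]
  [addCommGroupV : AddCommGroup V]
  [moduleE : Module K E]
  [moduleV : Module K V]
  [finiteE : FiniteDimensional K E]
  [finiteV : FiniteDimensional K V]
  μ : E →ₗ[K] V
  ν : E →ₗ[K] V

namespace TsfPair

attribute [instance] addCommGroupE addCommGroupV moduleE moduleV finiteE finiteV

variable {K : Type u} [Field K]

/-- A `K`-isomorphism of transformation-pairs: a pair `(α, β)` of linear isomorphisms with
`μ' ∘ α = β ∘ μ` and `ν' ∘ α = β ∘ ν`. -/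
structure Iso (P : TsfPair.{u, v} K) (Q : TsfPair.{u, w} K) where
  α : P.E ≃ₗ[K] Q.E
  β : P.V ≃ₗ[K] Q.V
  comm_μ : Q.μ ∘ₗ α.toLinearMap = β.toLinearMap ∘ₗ P.μ
  comm_ν : Q.ν ∘ₗ α.toLinearMap = β.toLinearMap ∘ₗ P.ν

/-- The direct sum of a finite family of transformation-pairs. As the family is finite, the
direct sums of the spaces are realized as products, on which the maps act componentwise. -/
def directSum {ι : Type w} [Finite ι] (P : ι → TsfPair.{u, v} K) : TsfPair.{u, max w v} K where
  E := ∀ i, (P i).E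
  V := ∀ i, (P i).V
  μ := LinearMap.pi fun i => (P i).μ ∘ₗ LinearMap.proj i
  ν := LinearMap.pi fun i => (P i).ν ∘ₗ LinearMap.proj i

/-- The linear map on `Kⁿ` that sends the `i`-th standard basis vector to `f i`. -/
def ofBasis {n : ℕ} {W : Type v} [AddCommGroup W] [Module K W] (f : Fin n → W) :
    (Fin n → K) →ₗ[K] W :=
  (Pi.basisFun K (Fin n)).constr K f

variable (K)

/-- The nilpotent map `f₁ ↦ f₂ ↦ ⋯ ↦ fₙ ↦ 0` on `Kⁿ`. -/
def shift (n : ℕ) : (Fin n → K) →ₗ[K] (Fin n → K) :=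
  ofBasis fun i => if h : (i : ℕ) + 1 < n then Pi.single ⟨(i : ℕ) + 1, h⟩ 1 else 0

/-- The type `⁰Tₙ`: the pair `[μₙ, Iₙ : Kⁿ → Kⁿ]`, with `μₙ` the nilpotent shift. -/
def zeroT (n : ℕ) : TsfPair.{u, u} K where
  E := Fin n → K
  V := Fin n → K
  μ := shift K n
  ν := LinearMap.id

/-- The type `Tₙ⁰`: the pair `[Iₙ, μₙ : Kⁿ → Kⁿ]`, with `μₙ` the nilpotent shift. -/
def tZero (n : ℕ) : TsfPair.{u, u} K where
  E := Fin n → K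
  V := Fin n → K
  μ := LinearMap.id
  ν := shift K n

/-- The type `Tₙ`: the pair `Kⁿ → Kⁿ⁺¹` with `κₙ fᵢ = fᵢ` and `λₙ fᵢ = fᵢ₊₁`. -/
def t (n : ℕ) : TsfPair.{u, u} K where
  E := Fin n → K
  V := Fin (n + 1) → K
  μ := ofBasis fun i => Pi.single i.castSucc 1
  ν := ofBasis fun i => Pi.single i.succ 1

/-- The type `⁰Tₙ⁰`: the pair `Kⁿ⁺¹ → Kⁿ` with `κ'ₙ fᵢ = fᵢ` for `i ≤ n`, `κ'ₙ fₙ₊₁ = 0`, and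
`λ'ₙ f₁ = 0`, `λ'ₙ fᵢ₊₁ = fᵢ`. -/
def zeroTZero (n : ℕ) : TsfPair.{u, u} K where
  E := Fin (n + 1) → K
  V := Fin n → K
  μ := ofBasis (Fin.lastCases (motive := fun _ => Fin n → K) 0 fun i => Pi.single i 1)
  ν := ofBasis (Fin.cases (motive := fun _ => Fin n → K) 0 fun i => Pi.single i 1)

/-- The pair `S(F) = [ξ, I : K[X]/(F) → K[X]/(F)]` of a monic polynomial `F`, where `ξ` is
multiplication by `X`. -/
def s (F : K[X]) (hF : F.Monic) : TsfPair.{u, u} K :=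
  haveI : FiniteDimensional K (K[X] ⧸ Ideal.span {F}) := hF.finite_quotient
  { E := K[X] ⧸ Ideal.span {F}
    V := K[X] ⧸ Ideal.span {F}
    μ := LinearMap.mulLeft K (Ideal.Quotient.mk (Ideal.span {F}) X)
    ν := LinearMap.id }

/-- The `K`-linearization `[μ_Γ, ν_Γ : K R → K S]` of the finite binary relation `Γ = (R, S)`:
on basis vectors, `μ_Γ (a, b) = a` and `ν_Γ (a, b) = b`. -/
def linearization {S : Type v} [Finite S] (R : Set (S × S)) : TsfPair.{u, max u v} K where
  E := R →₀ K
  V := S →₀ K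
  μ := Finsupp.lmapDomain K K fun e => e.1.1
  ν := Finsupp.lmapDomain K K fun e => e.1.2

end TsfPair

/-- The index set of Kronecker's list of indecomposable transformation-pairs over `K`. -/
inductive KroneckerType (K : Type u) [Field K] : Type u
  | zeroT (n : ℕ) (hn : 0 < n)
  | tZero (n : ℕ) (hn : 0 < n)
  | t (n : ℕ)
  | zeroTZero (n : ℕ)
  | s (p : K[X]) (n : ℕ) (monic : p.Monic) (irreducible : Irreducible p) (ne_X : p ≠ X)
      (hn : 0 < n)

namespace KroneckerType

variable {K : Type u} [Field K]

/-- The transformation-pair of a given type in Kronecker's list. -/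
def toPair : KroneckerType K → TsfPair.{u, u} K
  | zeroT n _ => TsfPair.zeroT K n
  | tZero n _ => TsfPair.tZero K n
  | t n => TsfPair.t K n
  | zeroTZero n => TsfPair.zeroTZero K n
  | s p n monic _ _ _ => TsfPair.s K (p ^ n) (monic.pow n)

/-- The edge-number of a type in Kronecker's list. -/
def edgeNumber : KroneckerType K → ℕ
  | zeroT n _ => n
  | tZero n _ => n
  | t n => n
  | zeroTZero n => n + 1
  | s p n _ _ _ _ => n * p.natDegree

/-- The vertex-number of a type in Kronecker's list. -/
def vertexNumber : KroneckerType K → ℕ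
  | zeroT n _ => n
  | tZero n _ => n
  | t n => n + 1
  | zeroTZero n => n
  | s p n _ _ _ _ => n * p.natDegree

/-- The direct sum `⨁_τ (m τ) • τ` over Kronecker's list, in which the type `τ` occurs `m τ`
times (and all but finitely many `m τ` are zero). -/
def multiple (m : KroneckerType K →₀ ℕ) : TsfPair.{u, u} K :=
  TsfPair.directSum fun i : (τ : m.support) × Fin (m τ) => i.1.1.toPair

end KroneckerType

/-- `m` is the family of multiplicities of a Kronecker decomposition of `π`, that is,
`π ≅ ⨁_τ (m τ) • τ`. -/
def IsKroneckerDecomposition {K : Type u} [Field K] (π : TsfPair.{u, v} K)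
    (m : KroneckerType K →₀ ℕ) : Prop :=
  Nonempty (TsfPair.Iso π (KroneckerType.multiple m))

end

namespace KroneckerType

variable {K : Type u} [Field K]

/-! Both identities are dimension counts. An isomorphism of pairs gives linear isomorphisms on the
`E` and `V` sides; `K R` and `K S` have dimensions `#R` and `#S`, dimension is additive over direct
sums, and each listed type has dimensions equal to its edge- and vertex-number. No property of the
maps `μ`, `ν` enters. -/

theorem finrank_toPair_E (τ : KroneckerType K) :
    Module.finrank K τ.toPair.E = τ.edgeNumber := by
  cases τ with
  | zeroT n _ => exact Module.finrank_fin_fun K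
  | tZero n _ => exact Module.finrank_fin_fun K
  | t n => exact Module.finrank_fin_fun K
  | zeroTZero n => exact Module.finrank_fin_fun K
  | s p n _ _ _ _ =>
    exact finrank_quotient_span_eq_natDegree.trans (natDegree_pow p n)

theorem finrank_toPair_V (τ : KroneckerType K) :
    Module.finrank K τ.toPair.V = τ.vertexNumber := by
  cases τ with
  | zeroT n _ => exact Module.finrank_fin_fun K
  | tZero n _ => exact Module.finrank_fin_fun K
  | t n => exact Module.finrank_fin_fun K
  | zeroTZero n => exact Module.finrank_fin_fun K
  | s p n _ _ _ _ =>
    exact finrank_quotient_span_eq_natDegree.trans (natDegree_pow p n)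

/-- Grouping the summands by type: the `m τ` copies of `τ` each contribute the same `f τ`. -/
theorem sum_sigma_eq_finsuppSum (m : KroneckerType K →₀ ℕ) (f : KroneckerType K → ℕ) :
    ∑ i : (τ : m.support) × Fin (m τ), f i.1.1 = m.sum fun τ k => k * f τ := by
  rw [Fintype.sum_sigma, Finsupp.sum, ← Finset.sum_coe_sort m.support]
  simp

theorem finrank_multiple_E (m : KroneckerType K →₀ ℕ) :
    Module.finrank K (multiple m).E = m.sum fun τ k => k * τ.edgeNumber := by
  refine (Module.finrank_pi_fintype K).trans ?_
  simp only [finrank_toPair_E]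
  exact sum_sigma_eq_finsuppSum m edgeNumber

theorem finrank_multiple_V (m : KroneckerType K →₀ ℕ) :
    Module.finrank K (multiple m).V = m.sum fun τ k => k * τ.vertexNumber := by
  refine (Module.finrank_pi_fintype K).trans ?_
  simp only [finrank_toPair_V]
  exact sum_sigma_eq_finsuppSum m vertexNumber

end KroneckerType

namespace TsfPair

variable (K : Type u) [Field K] {S : Type v} [Finite S] (R : Set (S × S))

theorem finrank_linearization_E : Module.finrank K (linearization K R).E = Nat.card R := by
  have := Fintype.ofFinite R
  rw [Nat.card_eq_fintype_card]
  exact Module.finrank_finsupp_self K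

theorem finrank_linearization_V : Module.finrank K (linearization K R).V = Nat.card S := by
  have := Fintype.ofFinite S
  rw [Nat.card_eq_fintype_card]
  exact Module.finrank_finsupp_self K

end TsfPair

theorem theorem5p4 {K : Type*} [Field K] {S : Type*} [Finite S] (R : Set (S × S))
    (m : KroneckerType K →₀ ℕ)
    (hm : IsKroneckerDecomposition (TsfPair.linearization K R) m) :
    Nat.card R = m.sum (fun τ k => k * τ.edgeNumber) ∧
    Nat.card S = m.sum (fun τ k => k * τ.vertexNumber) ∧
    (m (KroneckerType.zeroTZero 0) : ℤ) =
      (Nat.card R : ℤ) -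
        (((m.erase (KroneckerType.zeroTZero 0)).sum fun τ k => k * τ.edgeNumber : ℕ) : ℤ) := by
  obtain ⟨e⟩ := hm
  have hE : Nat.card R = m.sum (fun τ k => k * τ.edgeNumber) := by
    rw [← TsfPair.finrank_linearization_E K, e.α.finrank_eq, KroneckerType.finrank_multiple_E]
  have hV : Nat.card S = m.sum (fun τ k => k * τ.vertexNumber) := by
    rw [← TsfPair.finrank_linearization_V K R, e.β.finrank_eq, KroneckerType.finrank_multiple_V]
  refine ⟨hE, hV, ?_⟩
  -- Isolates the term of `⁰T₀⁰`. That type may be absent from the support, so the summand must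
  -- vanish at multiplicity `0`.
  have hsplit := Finsupp.add_sum_erase' m (KroneckerType.zeroTZero 0)
    (fun τ k => k * τ.edgeNumber) (fun _ => zero_mul _)
  -- `⁰T₀⁰` is the zero pair `K → 0`, with one edge: its multiplicity has coefficient `1` in the
  -- edge count, so it can be solved for without division.
  have hone : (KroneckerType.zeroTZero 0 : KroneckerType K).edgeNumber = 1 := rfl
  rw [hone, mul_one, ← hE] at hsplit
  omega
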